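/- Let $A=(A(y\mid x))_{x,y\in\mathbb N}$ be a Markov kernel on $\mathbb N$ and let $1\le G<\infty$, $0\le\theta<1$. Call $A$ (and any Markov chain with transition kernel $A$) $(G,\theta)$-geometrically ergodic if it has a unique stationary distribution $\pi$ and $$\sup_{x\in\mathbb N}\bigl\|\mathcal L(X_s\mid X_1=x)-\pi\bigr\|_{\mathrm{TV}}\le G\theta^{s-1},\qquad s=1,2,\ldots,$$ where $X$ denotes a chain with kernel $A$, $\|\cdot\|_{\mathrm{TV}}=\frac12\|\cdot\|_1$, and $0^0=1$. A hidden Markov chain with initial distribution $p_1$, transition kernel $A$ of its underlying Markov chain and emission probabilities $B$ (with $B(\cdot\mid x)$ a probability distribution on $\mathbb N$ for each $x\in\mathbb N$) is a sequence $Y_1,Y_2,\ldots$ of $\mathbb N$-valued random variables such that, for all $n$ and all $y\in\mathbb N^n$, $$\mathbb P(Y_1=y_1,\ldots,Y_n=y_n)=\sum_{x\in\mathbb N^n}p_1(x_1)\prod_{i=1}^{n-1}A(x_{i+1}\mid x_i)\prod_{i=1}^nB(y_i\mid x_i).$$ Theorem. Let $Y_1,Y_2,\ldots$ be an $\mathbb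 N$-valued hidden Markov chain whose underlying $\mathbb N$-valued Markov chain is $(G,\theta)$-geometrically ergodic. Let $n\in\mathbb N$, let $f:\mathbb N^n\to\mathbb R$ be $1$-Lipschitz for the Hamming metric $d(x,y)=\#\{i: x_i\ne y_i\}$, and let $\varepsilon\ge 0$. Then $f(Y_1,\ldots,Y_n)$ is integrable and $$\mathbb P\bigl(f(Y_1,\ldots,Y_n)-\mathbb E f(Y_1,\ldots,Y_n)>n\varepsilon\bigr)\le\exp\Bigl(-\frac{n(1-\theta)^2\varepsilon^2}{2G^2}\Bigr),$$ $$\mathbb P\bigl(f(Y_1,\ldots,Y_n)-\mathbb E f(Y_1,\ldots,Y_n)<-n\varepsilon\bigr)\le\exp\Bigl(-\frac{n(1-\theta)^2\varepsilon^2}{2G^2}\Bigr).$$ -/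

import Mathlib

open MeasureTheory

noncomputable section

/-- Total variation distance of two probability vectors on `ℕ`: half of the `ℓ¹` norm of
their difference. -/
def tvDist (φ ψ : PMF ℕ) : ℝ :=
  (1 / 2) * ∑' y : ℕ, |(φ y).toReal - (ψ y).toReal|

/-- A Markov kernel on `ℕ` is given by its columns: `A x` is the probability vector `A(· | x)`.
`stepLaw A k x` is the law of the chain after `k` steps when it is started at `x`. -/
def stepLaw (A : ℕ → PMF ℕ) : ℕ → ℕ → PMF ℕ
  | 0, x => PMF.pure x
  | k + 1, x => (stepLaw A k x).bind A

/-- `π` is the stationary distribution of the kernel `A`: the unique probability vector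
with `A π = π`. -/
def IsStationaryDistribution (A : ℕ → PMF ℕ) (π : PMF ℕ) : Prop :=
  π.bind A = π ∧ ∀ π' : PMF ℕ, π'.bind A = π' → π' = π

/-- `τ_s = sup_x ‖L(X_s | X_1 = x) - π‖_TV`, for `s ≥ 1`
(from `X_1` to `X_s` there are `s - 1` steps). -/
def inverseMixingTime (A : ℕ → PMF ℕ) (π : PMF ℕ) (s : ℕ) : ℝ :=
  ⨆ x : ℕ, tvDist (stepLaw A (s - 1) x) π

/-- `(G, θ)`-geometric ergodicity of (the chain with) the kernel `A`. -/
def IsGeometricallyErgodic (A : ℕ → PMF ℕ) (G θ : ℝ) : Prop :=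
  1 ≤ G ∧ 0 ≤ θ ∧ θ < 1 ∧
    ∃ π : PMF ℕ, IsStationaryDistribution A π ∧
      ∀ s : ℕ, 1 ≤ s → inverseMixingTime A π s ≤ G * θ ^ (s - 1)

/-- Probability of the trajectory `x = (x_1, …, x_n)` under the Markov chain with initial
distribution `p` and kernel `A`: `p(x_1) ∏_{i < n} A(x_{i+1} | x_i)`. -/
def markovMass (p : PMF ℕ) (A : ℕ → PMF ℕ) : (n : ℕ) → (Fin n → ℕ) → ENNReal
  | 0, _ => 1
  | n + 1, x => p (x 0) * ∏ i : Fin n, A (x i.castSucc) (x i.succ)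

/-- Probability of `y = (y_1, …, y_n)` under the hidden Markov chain `(p, A, B)`:
`∑_x P(X = x) ∏_i B(y_i | x_i)`. -/
def hiddenMarkovMass (p : PMF ℕ) (A B : ℕ → PMF ℕ) (n : ℕ) (y : Fin n → ℕ) : ENNReal :=
  ∑' x : Fin n → ℕ, markovMass p A n x * ∏ i : Fin n, B (x i) (y i)

/-- The process `Y` (with `Y 0, Y 1, …` in the role of `Y_1, Y_2, …`) is a hidden Markov chain
with initial distribution `p`, transition kernel `A` of the underlying chain and emission
probabilities `B`. -/
structure IsHiddenMarkovChain {Ω : Type*} [MeasurableSpace Ω] (P : Measure Ω)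
    (p : PMF ℕ) (A B : ℕ → PMF ℕ) (Y : ℕ → Ω → ℕ) : Prop where
  measurable : ∀ i : ℕ, Measurable (Y i)
  law : ∀ (n : ℕ) (y : Fin n → ℕ),
    P {ω | ∀ i : Fin n, Y i ω = y i} = hiddenMarkovMass p A B n y

end

/-! This is McDiarmid's argument with the pairs (X_i, Y_i) revealed one at a time: given X_i, the
future no longer depends on the past. The conditional mean of f given the first pair has oscillation
at most C = 2G/(1-θ). Changing the letter costs 1; changing the state costs at most the summed total
variation distances of the later state laws (`expect_hiddenLaw_sub_le`), a geometric series
(`one_add_sum_tvDist_stepLaw_le`). Hoeffding's lemma then yields a factor exp(C²s²/8) per pair, and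
induction on n gives `expect_exp_hiddenLaw_le`: f(Y) is sub-Gaussian with variance proxy nC²/4, and
the Chernoff bound finishes. -/

/-! ### Expectations under discrete laws -/

namespace PMF

/-- The expectation of a real function under a probability mass function. -/
noncomputable def expect {α : Type*} (q : PMF α) (g : α → ℝ) : ℝ := ∑' a, (q a).toReal * g a

variable {α β : Type*} (q : PMF α)

lemma summable_toReal : Summable fun a => (q a).toReal :=
  ENNReal.summable_toReal q.tsum_coe_ne_top

lemma tsum_toReal : ∑' a, (q a).toReal = 1 := by
  rw [← ENNReal.tsum_toReal_eq q.apply_ne_top, q.tsum_coe, ENNReal.toReal_one]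

lemma summable_expect {g : α → ℝ} {C : ℝ} (hg : ∀ a, |g a| ≤ C) :
    Summable fun a => (q a).toReal * g a := by
  refine Summable.of_norm_bounded (q.summable_toReal.mul_right C) fun a => ?_
  rw [Real.norm_eq_abs, abs_mul, abs_of_nonneg ENNReal.toReal_nonneg]
  exact mul_le_mul_of_nonneg_left (hg a) ENNReal.toReal_nonneg

@[simp] lemma expect_const (c : ℝ) : q.expect (fun _ => c) = c := by
  rw [expect, tsum_mul_right, tsum_toReal, one_mul]

lemma expect_mono {f g : α → ℝ} {C D : ℝ} (hf : ∀ a, |f a| ≤ C) (hg : ∀ a, |g a| ≤ D)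
    (h : ∀ a, f a ≤ g a) : q.expect f ≤ q.expect g :=
  (q.summable_expect hf).tsum_le_tsum
    (fun a => mul_le_mul_of_nonneg_left (h a) ENNReal.toReal_nonneg) (q.summable_expect hg)

lemma expect_add {f g : α → ℝ} {C D : ℝ} (hf : ∀ a, |f a| ≤ C) (hg : ∀ a, |g a| ≤ D) :
    q.expect (fun a => f a + g a) = q.expect f + q.expect g := by
  simp only [expect, mul_add]
  exact (q.summable_expect hf).tsum_add (q.summable_expect hg)

lemma expect_sub {f g : α → ℝ} {C D : ℝ} (hf : ∀ a, |f a| ≤ C) (hg : ∀ a, |g a| ≤ D) :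
    q.expect (fun a => f a - g a) = q.expect f - q.expect g := by
  simp only [expect, mul_sub]
  exact (q.summable_expect hf).tsum_sub (q.summable_expect hg)

lemma expect_mul_right (f : α → ℝ) (c : ℝ) :
    q.expect (fun a => f a * c) = q.expect f * c := by
  simp only [expect, ← mul_assoc, tsum_mul_right]

lemma abs_expect_le {g : α → ℝ} {C : ℝ} (hg : ∀ a, |g a| ≤ C) : |q.expect g| ≤ C := by
  have hc : ∀ c : ℝ, ∀ _ : α, |c| ≤ |c| := fun _ _ => le_rfl
  rw [abs_le]
  constructor
  · simpa using q.expect_mono (hc (-C)) hg fun a => (abs_le.1 (hg a)).1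
  · simpa using q.expect_mono hg (hc C) fun a => (abs_le.1 (hg a)).2

lemma ofReal_expect {g : α → ℝ} {C : ℝ} (h0 : ∀ a, 0 ≤ g a) (hg : ∀ a, |g a| ≤ C) :
    ENNReal.ofReal (q.expect g) = ∑' a, q a * ENNReal.ofReal (g a) := by
  rw [expect, ENNReal.ofReal_tsum_of_nonneg
    (fun a => mul_nonneg ENNReal.toReal_nonneg (h0 a)) (q.summable_expect hg)]
  congr 1 with a
  rw [ENNReal.ofReal_mul ENNReal.toReal_nonneg, ENNReal.ofReal_toReal (q.apply_ne_top a)]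

lemma expect_nonneg {g : α → ℝ} (h0 : ∀ a, 0 ≤ g a) : 0 ≤ q.expect g :=
  tsum_nonneg fun a => mul_nonneg ENNReal.toReal_nonneg (h0 a)

lemma expect_bind_of_nonneg (k : α → PMF β) {g : β → ℝ} {C : ℝ} (h0 : ∀ b, 0 ≤ g b)
    (hg : ∀ b, |g b| ≤ C) : (q.bind k).expect g = q.expect fun a => (k a).expect g := by
  have h1 : 0 ≤ q.expect fun a => (k a).expect g :=
    q.expect_nonneg fun a => (k a).expect_nonneg h0
  rw [← ENNReal.toReal_ofReal ((q.bind k).expect_nonneg h0), ← ENNReal.toReal_ofReal h1,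
    ofReal_expect _ h0 hg,
    ofReal_expect q (fun a => (k a).expect_nonneg h0) (fun a => (k a).abs_expect_le hg)]
  simp_rw [ofReal_expect _ h0 hg, bind_apply, ← ENNReal.tsum_mul_right, ← ENNReal.tsum_mul_left,
    mul_assoc]
  rw [ENNReal.tsum_comm]

/-- Adding the constant C makes g nonnegative, where Tonelli in `ENNReal` applies. -/
lemma expect_bind (k : α → PMF β) {g : β → ℝ} {C : ℝ} (hg : ∀ b, |g b| ≤ C) :
    (q.bind k).expect g = q.expect fun a => (k a).expect g := by
  have h0 : ∀ b, 0 ≤ g b + C := fun b => by linarith [(abs_le.1 (hg b)).1]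
  have h1 : ∀ b, |g b + C| ≤ C + |C| := fun b =>
    (abs_add_le _ _).trans (add_le_add (hg b) le_rfl)
  have h := q.expect_bind_of_nonneg k h0 h1
  simp_rw [expect_add _ hg (fun _ => le_refl |C|), expect_const] at h
  rw [expect_add q (fun a => (k a).abs_expect_le hg) (fun _ => le_refl |C|), expect_const] at h
  linarith

@[simp] lemma expect_pure (a : α) (g : α → ℝ) : (pure a).expect g = g a := by
  rw [expect, tsum_eq_single a]
  · simp
  · intro b hb
    simp [hb]

lemma expect_map (u : α → β) {g : β → ℝ} {C : ℝ} (hg : ∀ b, |g b| ≤ C) :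
    (q.map u).expect g = q.expect fun a => g (u a) := by
  rw [← bind_pure_comp, expect_bind q _ hg]
  simp

lemma integral_toMeasure [MeasurableSpace α] [DiscreteMeasurableSpace α] {g : α → ℝ} {C : ℝ}
    (hg : ∀ a, |g a| ≤ C) : ∫ a, g a ∂q.toMeasure = q.expect g := by
  rw [integral_eq_tsum q g]
  · rfl
  · exact Integrable.of_bound (Measurable.of_discrete).aestronglyMeasurable C
      (Filter.Eventually.of_forall hg)

/-- Hoeffding's lemma for a function of oscillation at most `C`. -/
lemma expect_exp_le [Nonempty α] [Countable α] {g : α → ℝ} {C : ℝ}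
    (hosc : ∀ a b, g a - g b ≤ C) (s : ℝ) :
    q.expect (fun a => Real.exp (s * g a)) ≤ Real.exp (s * q.expect g + C ^ 2 * s ^ 2 / 8) := by
  let _ : MeasurableSpace α := ⊤
  obtain ⟨a₀⟩ := ‹Nonempty α›
  have hC : 0 ≤ C := by simpa using hosc a₀ a₀
  have hbdd : BddBelow (Set.range g) := ⟨g a₀ - C, by
    rintro _ ⟨a, rfl⟩
    linarith [hosc a₀ a]⟩
  have : Nonempty α := ⟨a₀⟩
  -- Bounded oscillation confines g to an interval of length C starting at its infimum.
  have hIcc : ∀ a, g a ∈ Set.Icc (⨅ b, g b) ((⨅ b, g b) + C) := fun a =>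
    ⟨ciInf_le hbdd a, by
      have : g a - C ≤ ⨅ b, g b := le_ciInf fun b => by linarith [hosc a b]
      linarith⟩
  have hg : ∀ a, |g a| ≤ |g a₀| + C := fun a => by
    have h1 : |g a - g a₀| ≤ C := abs_sub_le_iff.2 ⟨hosc _ _, hosc _ _⟩
    calc |g a| = |g a₀ + (g a - g a₀)| := by ring_nf
      _ ≤ _ := (abs_add_le _ _).trans (by gcongr)
  have hexp : ∀ a, |Real.exp (s * (g a - q.expect g))|
      ≤ Real.exp (|s| * (|g a₀| + C + |q.expect g|)) := fun a => by
    rw [abs_of_pos (Real.exp_pos _), Real.exp_le_exp]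
    refine (le_abs_self _).trans ?_
    rw [abs_mul]
    gcongr
    exact (abs_sub _ _).trans (by gcongr; exact hg a)
  have h := (ProbabilityTheory.hasSubgaussianMGF_of_mem_Icc (μ := q.toMeasure) (X := g)
    Measurable.of_discrete.aemeasurable (Filter.Eventually.of_forall hIcc)).mgf_le s
  rw [ProbabilityTheory.mgf, integral_toMeasure q hg, integral_toMeasure q hexp] at h
  have e : ∀ a, Real.exp (s * g a)
      = Real.exp (s * (g a - q.expect g)) * Real.exp (s * q.expect g) := fun a => by
    rw [← Real.exp_add]; ring_nf
  simp_rw [e]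
  rw [expect_mul_right, add_comm, Real.exp_add]
  gcongr
  refine h.trans_eq ?_
  congr 1
  simp [abs_of_nonneg hC]
  ring

end PMF

/-! ### Total variation and mixing -/

lemma summable_tvDist (φ ψ : PMF ℕ) : Summable fun y => |(φ y).toReal - (ψ y).toReal| :=
  (φ.summable_toReal.sub ψ.summable_toReal).abs

lemma tvDist_comm (φ ψ : PMF ℕ) : tvDist φ ψ = tvDist ψ φ := by
  simp only [tvDist, abs_sub_comm]

lemma tvDist_triangle (φ ψ χ : PMF ℕ) : tvDist φ χ ≤ tvDist φ ψ + tvDist ψ χ := by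
  unfold tvDist
  rw [← mul_add, ← (summable_tvDist φ ψ).tsum_add (summable_tvDist ψ χ)]
  gcongr
  · exact summable_tvDist φ χ
  · exact (summable_tvDist φ ψ).add (summable_tvDist ψ χ)
  · exact abs_sub_le _ _ _

lemma tvDist_le_one (φ ψ : PMF ℕ) : tvDist φ ψ ≤ 1 := by
  have h : ∑' y, |(φ y).toReal - (ψ y).toReal| ≤ ∑' y, ((φ y).toReal + (ψ y).toReal) := by
    refine (summable_tvDist φ ψ).tsum_le_tsum (fun y => ?_)
      (φ.summable_toReal.add ψ.summable_toReal)
    refine (abs_sub _ _).trans_eq ?_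
    simp
  rw [φ.summable_toReal.tsum_add ψ.summable_toReal, φ.tsum_toReal, ψ.tsum_toReal] at h
  unfold tvDist
  linarith

/-- Both laws have mass 1, so g may be replaced by g - 1/2, whose absolute value is at most 1/2: the
factor in `tvDist`. -/
lemma expect_sub_expect_le_tvDist (φ ψ : PMF ℕ) {g : ℕ → ℝ} (h0 : ∀ a, 0 ≤ g a)
    (h1 : ∀ a, g a ≤ 1) : φ.expect g - ψ.expect g ≤ tvDist φ ψ := by
  have hb : ∀ a, |g a - 1 / 2| ≤ 1 / 2 := fun a => by
    rw [abs_le]; constructor <;> linarith [h0 a, h1 a]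
  have hg : ∀ a, |g a| ≤ 1 := fun a => by rw [abs_of_nonneg (h0 a)]; exact h1 a
  have hc : ∀ _ : ℕ, |(1 / 2 : ℝ)| ≤ |1 / 2| := fun _ => le_rfl
  have e : φ.expect g - ψ.expect g
      = φ.expect (fun a => g a - 1 / 2) - ψ.expect fun a => g a - 1 / 2 := by
    rw [φ.expect_sub hg hc, ψ.expect_sub hg hc]; simp
  rw [e, PMF.expect, PMF.expect, ← (φ.summable_expect hb).tsum_sub (ψ.summable_expect hb), tvDist,
    ← tsum_mul_left]
  refine ((φ.summable_expect hb).sub (ψ.summable_expect hb)).tsum_le_tsum (fun a => ?_)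
    ((summable_tvDist φ ψ).mul_left _)
  rw [← sub_mul, mul_comm (1 / 2 : ℝ)]
  refine (le_abs_self _).trans ?_
  rw [abs_mul]
  exact mul_le_mul_of_nonneg_left (hb a) (abs_nonneg _)

/-- `stepLaw` appends steps at the end, whereas the recursion for the hidden chain peels off the
first one. -/
lemma bind_stepLaw (A : ℕ → PMF ℕ) (k x : ℕ) :
    (A x).bind (stepLaw A k) = stepLaw A (k + 1) x := by
  induction k generalizing x with
  | zero => simp [stepLaw]
  | succ k ih =>
    have : (A x).bind (stepLaw A (k + 1)) = ((A x).bind (stepLaw A k)).bind A := by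
      rw [PMF.bind_bind]; rfl
    rw [this, ih]; rfl

lemma tvDist_stepLaw_le {A : ℕ → PMF ℕ} {G θ : ℝ} (hA : IsGeometricallyErgodic A G θ)
    (k x x' : ℕ) : tvDist (stepLaw A k x) (stepLaw A k x') ≤ 2 * G * θ ^ k := by
  obtain ⟨-, -, -, π, -, h⟩ := hA
  have key : ∀ z, tvDist (stepLaw A k z) π ≤ G * θ ^ k := fun z => by
    refine le_trans ?_ (h (k + 1) (by omega))
    -- A real supremum dominates its terms only for a bounded family; here 1 is a bound.
    exact le_ciSup (f := fun z => tvDist (stepLaw A k z) π)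
      ⟨1, by rintro _ ⟨z, rfl⟩; exact tvDist_le_one _ _⟩ z
  have := tvDist_triangle (stepLaw A k x) π (stepLaw A k x')
  rw [tvDist_comm π] at this
  linarith [key x, key x']

/-- Since G ≥ 1, the leading 1 is absorbed as the missing zeroth term 2G of the geometric series. -/
lemma one_add_sum_tvDist_stepLaw_le {A : ℕ → PMF ℕ} {G θ : ℝ} (hA : IsGeometricallyErgodic A G θ)
    (n x x' : ℕ) :
    1 + ∑ k ∈ Finset.range n, tvDist (stepLaw A (k + 1) x) (stepLaw A (k + 1) x')
      ≤ 2 * G / (1 - θ) := by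
  have hG := hA.1
  have h0 := hA.2.1
  have h1 := hA.2.2.1
  calc _ ≤ 2 * G + ∑ k ∈ Finset.range n, 2 * G * θ ^ (k + 1) := by
        gcongr with k _
        · linarith
        · exact tvDist_stepLaw_le hA _ _ _
    _ = 2 * G * ∑ k ∈ Finset.range (n + 1), θ ^ k := by
        rw [Finset.sum_range_succ', pow_zero, mul_add, Finset.mul_sum]
        ring
    _ ≤ 2 * G * (1 - θ)⁻¹ := by
        gcongr
        rw [← tsum_geometric_of_lt_one h0 h1]
        exact (summable_geometric_of_lt_one h0 h1).sum_le_tsum _ fun _ _ => by positivity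
    _ = _ := by rw [div_eq_mul_inv]

/-! ### Lipschitz functions for the Hamming metric -/

section Hamming

lemma hammingDist_cons {n : ℕ} (a b : ℕ) (x y : Fin n → ℕ) :
    hammingDist (Fin.cons a x : Fin (n + 1) → ℕ) (Fin.cons b y)
      = (if a = b then 0 else 1) + hammingDist x y := by
  simp only [hammingDist, Finset.card_filter, Fin.sum_univ_succ, Fin.cons_zero, Fin.cons_succ]
  congr 1
  by_cases h : a = b <;> simp [h]

/-- Being `1`-Lipschitz for the Hamming metric. -/
def HammingLipschitz {n : ℕ} (f : (Fin n → ℕ) → ℝ) : Prop :=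
  ∀ x y, |f x - f y| ≤ (hammingDist x y : ℝ)

variable {n : ℕ}

lemma HammingLipschitz.abs_le {f : (Fin n → ℕ) → ℝ} (hf : HammingLipschitz f) (x : Fin n → ℕ) :
    |f x| ≤ |f 0| + n := by
  have h1 : |f x - f 0| ≤ n := (hf x 0).trans (by
    exact_mod_cast (hammingDist_le_card_fintype).trans_eq (Fintype.card_fin n))
  calc |f x| = |f 0 + (f x - f 0)| := by ring_nf
    _ ≤ _ := (abs_add_le _ _).trans (by gcongr)

lemma HammingLipschitz.neg {f : (Fin n → ℕ) → ℝ} (hf : HammingLipschitz f) :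
    HammingLipschitz fun x => -f x := fun x y => by
  rw [neg_sub_neg, abs_sub_comm]; exact hf x y

lemma HammingLipschitz.cons {f : (Fin (n + 1) → ℕ) → ℝ} (hf : HammingLipschitz f) (a : ℕ) :
    HammingLipschitz fun x : Fin n → ℕ => f (Fin.cons a x) := fun x y => by
  simpa [hammingDist_cons] using hf (Fin.cons a x) (Fin.cons a y)

lemma HammingLipschitz.sub_le_one {f : (Fin (n + 1) → ℕ) → ℝ} (hf : HammingLipschitz f)
    (a b : ℕ) (x : Fin n → ℕ) : f (Fin.cons a x) - f (Fin.cons b x) ≤ 1 := by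
  refine (le_abs_self _).trans ((hf _ _).trans ?_)
  rw [hammingDist_cons, hammingDist_self]
  split_ifs <;> simp

lemma HammingLipschitz.bddBelow {f : (Fin (n + 1) → ℕ) → ℝ} (hf : HammingLipschitz f)
    (x : Fin n → ℕ) : BddBelow (Set.range fun a : ℕ => f (Fin.cons a x)) :=
  ⟨f (Fin.cons 0 x) - 1, by rintro _ ⟨a, rfl⟩; linarith [hf.sub_le_one 0 a x]⟩

lemma HammingLipschitz.iInf {f : (Fin (n + 1) → ℕ) → ℝ} (hf : HammingLipschitz f) :
    HammingLipschitz fun x : Fin n → ℕ => ⨅ a : ℕ, f (Fin.cons a x) := by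
  have key : ∀ x y : Fin n → ℕ, (⨅ a : ℕ, f (Fin.cons a x)) - ⨅ a : ℕ, f (Fin.cons a y)
      ≤ hammingDist x y := fun x y => by
    have : (⨅ a : ℕ, f (Fin.cons a x)) - hammingDist x y ≤ ⨅ a : ℕ, f (Fin.cons a y) :=
      le_ciInf fun a => by
        have h1 := ciInf_le (hf.bddBelow x) a
        have h2 := (_root_.abs_le.1 (hf.cons a x y)).2
        linarith
    linarith
  intro x y
  refine abs_sub_le_iff.2 ⟨key x y, ?_⟩
  rw [hammingDist_comm]
  exact key y x

end Hamming

/-! ### Sensitivity and exponential moments of the hidden chain -/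

section HiddenLaw

variable (A B : ℕ → PMF ℕ)

/-- The law of `(Y_1, …, Y_n)` for the hidden Markov chain `(q, A, B)`, defined by conditioning on
the first step. -/
noncomputable def hiddenLaw : (n : ℕ) → PMF ℕ → PMF (Fin n → ℕ)
  | 0, _ => PMF.pure 0
  | n + 1, q => q.bind fun x => (B x).bind fun y =>
      (hiddenLaw n (A x)).map (Fin.cons (α := fun _ => ℕ) y)

variable {A B}

lemma expect_hiddenLaw_succ {n : ℕ} (q : PMF ℕ) {f : (Fin (n + 1) → ℕ) → ℝ} {C : ℝ}
    (hf : ∀ y, |f y| ≤ C) :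
    (hiddenLaw A B (n + 1) q).expect f = q.expect fun x => (B x).expect fun y =>
      (hiddenLaw A B n (A x)).expect fun z => f (Fin.cons y z) := by
  rw [hiddenLaw, PMF.expect_bind _ _ hf]
  simp_rw [PMF.expect_bind _ _ hf, PMF.expect_map _ _ hf]

lemma hiddenLaw_bind (n : ℕ) (q : PMF ℕ) (k : ℕ → PMF ℕ) :
    hiddenLaw A B n (q.bind k) = q.bind fun x => hiddenLaw A B n (k x) := by
  cases n with
  | zero => simp [hiddenLaw]
  | succ n => simp [hiddenLaw, PMF.bind_bind]

/-- No coupling is needed. Subtracting from f its infimum g over the first letter leaves a remainder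
in [0, 1], whose conditional mean given X_1 costs one total variation distance. As g is again
Lipschitz and ignores the first letter, induction applies to it with initial laws qA and q'A. -/
lemma expect_hiddenLaw_sub_le (n : ℕ) (q q' : PMF ℕ) {f : (Fin n → ℕ) → ℝ}
    (hf : HammingLipschitz f) :
    (hiddenLaw A B n q).expect f - (hiddenLaw A B n q').expect f
      ≤ ∑ k ∈ Finset.range n, tvDist (q.bind (stepLaw A k)) (q'.bind (stepLaw A k)) := by
  induction n generalizing q q' with
  | zero => simp [hiddenLaw]
  | succ n ih =>
    set g : (Fin n → ℕ) → ℝ := fun x => ⨅ a : ℕ, f (Fin.cons a x) with hg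
    have hgL : HammingLipschitz g := hf.iInf
    have h0 : ∀ a x, 0 ≤ f (Fin.cons a x) - g x := fun a x =>
      sub_nonneg.2 (ciInf_le (hf.bddBelow x) a)
    have h1 : ∀ a x, f (Fin.cons a x) - g x ≤ 1 := fun a x => by
      have : f (Fin.cons a x) - 1 ≤ g x := le_ciInf fun b => by linarith [hf.sub_le_one a b x]
      linarith
    have habs : ∀ a x, |f (Fin.cons a x) - g x| ≤ 1 := fun a x => by
      rw [abs_of_nonneg (h0 a x)]; exact h1 a x
    set φ : ℕ → ℝ := fun x => (B x).expect fun y => (hiddenLaw A B n (A x)).expect fun z =>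
      f (Fin.cons y z) - g z with hφ
    have hφ0 : ∀ x, 0 ≤ φ x := fun x =>
      PMF.expect_nonneg _ fun y => PMF.expect_nonneg _ fun z => h0 y z
    have hφ1 : ∀ x, |φ x| ≤ 1 := fun x =>
      PMF.abs_expect_le _ fun y => PMF.abs_expect_le _ fun z => habs y z
    have dec : ∀ r : PMF ℕ, (hiddenLaw A B (n + 1) r).expect f
        = r.expect φ + (hiddenLaw A B n (r.bind A)).expect g := fun r => by
      rw [expect_hiddenLaw_succ r hf.abs_le, hiddenLaw_bind, PMF.expect_bind _ _ hgL.abs_le,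
        ← PMF.expect_add r hφ1 (fun x => PMF.abs_expect_le _ hgL.abs_le)]
      congr 1 with x
      have : ∀ y, (hiddenLaw A B n (A x)).expect (fun z => f (Fin.cons y z))
          = ((hiddenLaw A B n (A x)).expect fun z => f (Fin.cons y z) - g z)
            + (hiddenLaw A B n (A x)).expect g := fun y => by
        rw [← PMF.expect_add _ (habs y) hgL.abs_le]
        simp
      simp_rw [this]
      rw [PMF.expect_add _ (fun y => PMF.abs_expect_le _ (habs y)) (fun _ => le_rfl),
        PMF.expect_const]
    have hbind : ∀ (r : PMF ℕ) (k : ℕ),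
        (r.bind A).bind (stepLaw A k) = r.bind (stepLaw A (k + 1)) := fun r k => by
      simp_rw [PMF.bind_bind, bind_stepLaw]
    have hpure : ∀ r : PMF ℕ, r.bind (stepLaw A 0) = r := fun r => PMF.bind_pure r
    have h2 := expect_sub_expect_le_tvDist q q' hφ0 fun x => (le_abs_self _).trans (hφ1 x)
    have h3 := ih (q.bind A) (q'.bind A) hgL
    simp_rw [hbind] at h3
    rw [Finset.sum_range_succ', hpure, hpure, dec, dec]
    linarith

/-- The exponential moment bound behind McDiarmid's inequality, for a hidden Markov chain. -/
lemma expect_exp_hiddenLaw_le {C : ℝ} (hC : ∀ n x x', 1 + ∑ k ∈ Finset.range n,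
      tvDist (stepLaw A (k + 1) x) (stepLaw A (k + 1) x') ≤ C)
    (n : ℕ) (q : PMF ℕ) {f : (Fin n → ℕ) → ℝ} (hf : HammingLipschitz f) (s : ℝ) :
    (hiddenLaw A B n q).expect (fun y => Real.exp (s * f y))
      ≤ Real.exp (s * (hiddenLaw A B n q).expect f + n * (C ^ 2 * s ^ 2 / 8)) := by
  induction n generalizing q with
  | zero => simp [hiddenLaw]
  | succ n ih =>
    have hexp : ∀ {D : ℝ} (t : ℝ), |t| ≤ D → |Real.exp (s * t)| ≤ Real.exp (|s| * D) := by
      intro D t ht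
      rw [abs_of_pos (Real.exp_pos _), Real.exp_le_exp]
      exact (le_abs_self _).trans (by rw [abs_mul]; gcongr)
    set D := |f 0| + (n + 1 : ℕ) with hD
    set g : ℕ × ℕ → ℝ := fun w =>
      (hiddenLaw A B n (A w.1)).expect fun z => f (Fin.cons w.2 z) with hg
    have hgD : ∀ w, |g w| ≤ D := fun w => PMF.abs_expect_le _ fun z => hf.abs_le _
    -- The joint law of (X_1, Y_1).
    set r : PMF (ℕ × ℕ) := q.bind fun x => (B x).map (Prod.mk x) with hr
    have hrE : ∀ {D' : ℝ} {u : ℕ × ℕ → ℝ}, (∀ w, |u w| ≤ D') →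
        r.expect u = q.expect fun x => (B x).expect fun y => u (x, y) := by
      intro D' u hu
      rw [hr, PMF.expect_bind _ _ hu]
      simp_rw [PMF.expect_map _ _ hu]
    -- First change the state with the letter fixed, then the letter. The tails start from the laws
    -- A(· | x), so the distances begin at step 1.
    have hosc : ∀ w w', g w - g w' ≤ C := fun w w' => by
      have h1 := expect_hiddenLaw_sub_le (A := A) (B := B) n (A w.1) (A w'.1) (hf.cons w.2)
      simp_rw [bind_stepLaw] at h1
      have h2 : (hiddenLaw A B n (A w'.1)).expect (fun z => f (Fin.cons w.2 z)) - g w' ≤ 1 := by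
        rw [hg, ← PMF.expect_sub _ (hf.cons _).abs_le (hf.cons _).abs_le]
        refine (le_abs_self _).trans (PMF.abs_expect_le _ fun z => ?_)
        exact abs_sub_le_iff.2 ⟨hf.sub_le_one _ _ _, hf.sub_le_one _ _ _⟩
      have h3 := hC n w.1 w'.1
      have h4 : g w = (hiddenLaw A B n (A w.1)).expect fun z => f (Fin.cons w.2 z) := rfl
      linarith
    have hE : (hiddenLaw A B (n + 1) q).expect f = r.expect g := by
      rw [expect_hiddenLaw_succ q hf.abs_le, hrE hgD]
    set K := n * (C ^ 2 * s ^ 2 / 8) with hK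
    calc (hiddenLaw A B (n + 1) q).expect (fun y => Real.exp (s * f y))
        = r.expect fun w => (hiddenLaw A B n (A w.1)).expect
            fun z => Real.exp (s * f (Fin.cons w.2 z)) := by
          rw [expect_hiddenLaw_succ q (fun y => hexp _ (hf.abs_le y)),
            hrE (fun w => PMF.abs_expect_le _ fun z => hexp _ (hf.abs_le _))]
      _ ≤ r.expect fun w => Real.exp (s * g w) * Real.exp K := by
          refine PMF.expect_mono r (fun w => PMF.abs_expect_le _ fun z => hexp _ (hf.abs_le _))
            (D := Real.exp (|s| * D) * Real.exp K) (fun w => ?_) (fun w => ?_)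
          · rw [abs_mul, abs_of_pos (Real.exp_pos K)]
            gcongr
            exact hexp _ (hgD w)
          · rw [← Real.exp_add]
            exact ih (A w.1) (hf.cons w.2)
      _ = r.expect (fun w => Real.exp (s * g w)) * Real.exp K := PMF.expect_mul_right _ _ _
      _ ≤ Real.exp (s * r.expect g + C ^ 2 * s ^ 2 / 8) * Real.exp K := by
          gcongr
          exact r.expect_exp_le hosc s
      _ = _ := by
          rw [← Real.exp_add, hE, hK]
          congr 1
          push_cast
          ring

end HiddenLaw

/-! ### The recursive law agrees with the sum over paths -/

section HiddenMass

variable (p : PMF ℕ) (A B : ℕ → PMF ℕ)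

lemma markovMass_cons (n a : ℕ) (x : Fin n → ℕ) :
    markovMass p A (n + 1) (Fin.cons a x) = p a * markovMass (A a) A n x := by
  cases n with
  | zero => simp [markovMass]
  | succ n =>
    simp only [markovMass, Fin.prod_univ_succ (n := n), Fin.cons_zero]
    congr 1

lemma hiddenMarkovMass_succ (n : ℕ) (y : Fin (n + 1) → ℕ) :
    hiddenMarkovMass p A B (n + 1) y
      = ∑' x, p x * (B x (y 0) * hiddenMarkovMass (A x) A B n (Fin.tail y)) := by
  rw [hiddenMarkovMass, ← (Fin.consEquiv fun _ => ℕ).tsum_eq, ENNReal.tsum_prod']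
  congr 1 with a
  rw [hiddenMarkovMass, ← ENNReal.tsum_mul_left, ← ENNReal.tsum_mul_left]
  congr 1 with x
  have h : (Fin.consEquiv fun _ => ℕ) (a, x) = (Fin.cons a x : Fin (n + 1) → ℕ) := rfl
  simp only [h, markovMass_cons, Fin.prod_univ_succ, Fin.cons_zero, Fin.cons_succ, Fin.tail]
  ring

lemma hiddenLaw_apply (n : ℕ) (y : Fin n → ℕ) :
    hiddenLaw A B n p y = hiddenMarkovMass p A B n y := by
  induction n generalizing p with
  | zero => simp [hiddenLaw, hiddenMarkovMass, markovMass, Subsingleton.elim y 0]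
  | succ n ih =>
    rw [hiddenMarkovMass_succ, hiddenLaw, PMF.bind_apply]
    congr 1 with x
    congr 1
    rw [PMF.bind_apply, tsum_eq_single (y 0), PMF.map_apply, tsum_eq_single (Fin.tail y),
      if_pos (Fin.cons_self_tail y).symm, ih]
    · intro z hz
      rw [if_neg]
      intro h
      exact hz (by rw [h, Fin.tail_cons])
    · intro b hb
      rw [PMF.map_apply]
      simp only [mul_eq_zero, ENNReal.tsum_eq_zero]
      refine Or.inr fun z => if_neg ?_
      rintro rfl
      exact hb rfl

end HiddenMass

/-! ### Transfer to the process and Chernoff bound -/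

section HiddenChain

variable {Ω : Type*} [MeasurableSpace Ω] {P : Measure Ω} {p : PMF ℕ} {A B : ℕ → PMF ℕ}
  {Y : ℕ → Ω → ℕ}

lemma IsHiddenMarkovChain.measurable_prefix (hY : IsHiddenMarkovChain P p A B Y) (n : ℕ) :
    Measurable fun ω (i : Fin n) => Y i ω :=
  measurable_pi_lambda _ fun i => hY.measurable i

lemma IsHiddenMarkovChain.map_eq (hY : IsHiddenMarkovChain P p A B Y) (n : ℕ) :
    P.map (fun ω (i : Fin n) => Y i ω) = (hiddenLaw A B n p).toMeasure := by
  refine Measure.ext_of_singleton fun y => ?_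
  rw [Measure.map_apply (hY.measurable_prefix n) (measurableSet_singleton y),
    PMF.toMeasure_apply_singleton _ _ (measurableSet_singleton y), hiddenLaw_apply, ← hY.law n y]
  congr 1 with ω
  simp [funext_iff]

lemma IsHiddenMarkovChain.integral_eq (hY : IsHiddenMarkovChain P p A B Y) {n : ℕ}
    {g : (Fin n → ℕ) → ℝ} {C : ℝ} (hg : ∀ y, |g y| ≤ C) :
    ∫ ω, g (fun i : Fin n => Y i ω) ∂P = (hiddenLaw A B n p).expect g := by
  rw [← PMF.integral_toMeasure _ hg, ← hY.map_eq n, integral_map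
    (hY.measurable_prefix n).aemeasurable Measurable.of_discrete.aestronglyMeasurable]

lemma IsHiddenMarkovChain.integrable [IsFiniteMeasure P] (hY : IsHiddenMarkovChain P p A B Y)
    {n : ℕ} {g : (Fin n → ℕ) → ℝ} {C : ℝ} (hg : ∀ y, |g y| ≤ C) :
    Integrable (fun ω => g (fun i : Fin n => Y i ω)) P :=
  Integrable.of_bound
    (Measurable.of_discrete.comp (hY.measurable_prefix n)).aestronglyMeasurable C
    (Filter.Eventually.of_forall fun _ => hg _)

lemma IsHiddenMarkovChain.hasSubgaussianMGF [IsProbabilityMeasure P]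
    (hY : IsHiddenMarkovChain P p A B Y) {G θ : ℝ} (hA : IsGeometricallyErgodic A G θ) {n : ℕ}
    {f : (Fin n → ℕ) → ℝ} (hf : HammingLipschitz f) :
    ProbabilityTheory.HasSubgaussianMGF
      (fun ω => f (fun i : Fin n => Y i ω) - ∫ ω', f (fun i : Fin n => Y i ω') ∂P)
      (n * (G / (1 - θ)).toNNReal ^ 2) P := by
  have hpos : 0 ≤ G / (1 - θ) := div_nonneg (by linarith [hA.1]) (by linarith [hA.2.2.1])
  rw [hY.integral_eq hf.abs_le]
  set m := (hiddenLaw A B n p).expect f with hm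
  have hexp : ∀ (t : ℝ) (y : Fin n → ℕ), |Real.exp (t * f y)| ≤ Real.exp (|t| * (|f 0| + n)) := by
    intro t y
    rw [abs_of_pos (Real.exp_pos _), Real.exp_le_exp]
    refine (le_abs_self _).trans ?_
    rw [abs_mul]
    gcongr
    exact hf.abs_le y
  have e : ∀ t ω, Real.exp (t * (f (fun i : Fin n => Y i ω) - m))
      = Real.exp (t * f (fun i : Fin n => Y i ω)) * Real.exp (-(t * m)) := fun t ω => by
    rw [← Real.exp_add]; ring_nf
  refine ⟨fun t => ?_, fun t => ?_⟩
  · simp_rw [e]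
    exact (hY.integrable (hexp t)).mul_const _
  · rw [ProbabilityTheory.mgf]
    simp_rw [e]
    rw [integral_mul_const, hY.integral_eq (hexp t)]
    -- With C = 2G/(1-θ), C²/8 equals (G/(1-θ))²/2, which matches the proxy.
    calc _ ≤ Real.exp (t * m + n * ((2 * G / (1 - θ)) ^ 2 * t ^ 2 / 8)) * Real.exp (-(t * m)) := by
          gcongr
          exact expect_exp_hiddenLaw_le (one_add_sum_tvDist_stepLaw_le hA) n p hf t
      _ = _ := by
          rw [← Real.exp_add]
          push_cast
          rw [Real.coe_toNNReal _ hpos]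
          congr 1
          ring

lemma IsHiddenMarkovChain.measureReal_le [IsProbabilityMeasure P]
    (hY : IsHiddenMarkovChain P p A B Y) {G θ : ℝ} (hA : IsGeometricallyErgodic A G θ) {n : ℕ}
    {f : (Fin n → ℕ) → ℝ} (hf : HammingLipschitz f) {ε : ℝ} (hε : 0 ≤ ε) :
    P.real {ω | f (fun i : Fin n => Y i ω) - ∫ ω', f (fun i : Fin n => Y i ω') ∂P > n * ε}
      ≤ Real.exp (-(n * (1 - θ) ^ 2 * ε ^ 2 / (2 * G ^ 2))) := by
  have hG : G ≠ 0 := by linarith [hA.1]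
  have hθ : 1 - θ ≠ 0 := by linarith [hA.2.2.1]
  have hpos : 0 ≤ G / (1 - θ) := div_nonneg (by linarith [hA.1]) (by linarith [hA.2.2.1])
  refine (measureReal_mono ?_ (measure_ne_top P _)).trans
    (((hY.hasSubgaussianMGF hA hf).measure_ge_le (ε := n * ε) (by positivity)).trans_eq ?_)
  · exact Set.ofPred_subset_ofPred.2 fun ω hω => le_of_lt hω
  congr 1
  push_cast
  rw [Real.coe_toNNReal _ hpos]
  -- For n = 0 the proxy vanishes, and division by zero makes both exponents 0.
  rcases Nat.eq_zero_or_pos n with rfl | hn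
  · simp
  · field_simp

end HiddenChain

theorem theorem1 {Ω : Type*} [MeasurableSpace Ω] (P : Measure Ω) [IsProbabilityMeasure P]
    (p : PMF ℕ) (A B : ℕ → PMF ℕ) (Y : ℕ → Ω → ℕ)
    (hY : IsHiddenMarkovChain P p A B Y)
    (G θ : ℝ) (hA : IsGeometricallyErgodic A G θ)
    (n : ℕ) (f : (Fin n → ℕ) → ℝ)
    (hf : ∀ x y : Fin n → ℕ, |f x - f y| ≤ (hammingDist x y : ℝ))
    (ε : ℝ) (hε : 0 ≤ ε) :
    Integrable (fun ω => f (fun i : Fin n => Y i ω)) P ∧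
    P.real {ω | f (fun i : Fin n => Y i ω) - ∫ ω', f (fun i : Fin n => Y i ω') ∂P > n * ε}
      ≤ Real.exp (-(n * (1 - θ) ^ 2 * ε ^ 2 / (2 * G ^ 2))) ∧
    P.real {ω | f (fun i : Fin n => Y i ω) - ∫ ω', f (fun i : Fin n => Y i ω') ∂P < -(n * ε)}
      ≤ Real.exp (-(n * (1 - θ) ^ 2 * ε ^ 2 / (2 * G ^ 2))) := by
  have hn : ∀ ω, -f (fun i : Fin n => Y i ω) - ∫ ω', -f (fun i : Fin n => Y i ω') ∂P
      = -(f (fun i : Fin n => Y i ω) - ∫ ω', f (fun i : Fin n => Y i ω') ∂P) := fun ω => by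
    rw [integral_neg]; ring
  refine ⟨hY.integrable (HammingLipschitz.abs_le hf), hY.measureReal_le hA hf hε, ?_⟩
  -- The lower tail of f is the upper tail of -f.
  have h := hY.measureReal_le hA (HammingLipschitz.neg hf) hε
  simp_rw [hn, gt_iff_lt, lt_neg] at h
  exact h
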